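/- Let $\mathcal H,\mathcal K$ be complex Hilbert spaces (not necessarily separable), with inner products linear in the second argument. A POVM on $\mathbb R$ is a map $E:\mathcal B(\mathbb R)\to L(\mathcal H)$, countably additive in the strong operator topology, with $E(X)\ge 0$ for every Borel set $X$; it is normalized if $E(\mathbb R)=I$, and a spectral measure is a normalized POVM whose values are orthogonal projections. Put $E_{\psi,\varphi}(X)=\langle\psi|E(X)\varphi\rangle$, a complex measure with total variation $|E_{\psi,\varphi}|$. For $k\in\mathbb N=\{0,1,2,\dots\}$ the moment operators of $E$ are the following. * $E[k]$ has domain $\{\varphi\in\mathcal H:\int|x|^k\,d|E_{\psi,\varphi}|<\infty\ \text{for all }\psi\in\mathcal H\}$, and $\langle\psi|E[k]\varphi\rangle=\int x^k\,dE_{\psi,\varphi}$ for all $\psi\in\mathcal H$. * $\tilde E[k]$ is the restriction of $E[k]$ to $D(\tilde E[k])=\{\varphi\in\mathcal H:\int x^{2k}\,dE_{\varphi,\varphi}<\infty\}$ (which is contained in the domain of $E[k]$). * If the form domain $\mathcal D_F(x^k)=\{\varphi\in\mathcal H:\int|x|^k\,dE_{\varphi,\varphi}<\infty\}$ is dense in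 $\mathcal H$, then $E'[k]$ has domain $\{\varphi\in\mathcal D_F(x^k):\ \mathcal D_F(x^k)\ni\psi\mapsto\int x^k\,dE_{\psi,\varphi}\ \text{is continuous}\}$, and $\langle\psi|E'[k]\varphi\rangle=\int x^k\,dE_{\psi,\varphi}$ for all $\psi\in\mathcal D_F(x^k)$. Let $E:\mathcal B(\mathbb R)\to L(\mathcal H)$ be a normalized POVM and $(\mathcal K,F,V)$ a Naimark dilation of $E$, i.e. $F:\mathcal B(\mathbb R)\to L(\mathcal K)$ is a spectral measure and $V:\mathcal H\to\mathcal K$ is a bounded linear map with $E(X)=V^*F(X)V$ for all $X\in\mathcal B(\mathbb R)$. Let $j\in\mathbb N$ and suppose that $\mathcal D_F(x^{2j})=D(\tilde E[j])$ is dense in $\mathcal H$. Equalities of unbounded operators include equality of domains, compositions are taken on their natural domains, and adjoints are those of densely defined operators. (a) If $V^*F[j]=(F[j]V)^*$, then $\tilde E[2j]=E'[2j]$. (b) If $F[j]\big(D(F[j])\cap V(\mathcal H)\big)\subseteq V(\mathcal H)$, then $E'[2j]=\tilde E[j]^*\tilde E[j]$. -/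

import Mathlib

open MeasureTheory Filter Topology
open scoped ComplexConjugate InnerProductSpace Function

noncomputable section

section Measures

variable {Ω : Type*} [MeasurableSpace Ω]

lemma complexMeasure_isFiniteMeasure_variation (μ : ComplexMeasure Ω) :
    IsFiniteMeasure μ.variation := by
  have hle : μ.variation ≤ (ComplexMeasure.re μ).variation + (ComplexMeasure.im μ).variation := by
    refine VectorMeasure.variation_le_of_forall_enorm_le fun X _ => ?_
    refine le_trans ?_ (add_le_add (VectorMeasure.enorm_measure_le_variation _ X)
      (VectorMeasure.enorm_measure_le_variation _ X))
    have h : μ X = ((μ X).re : ℂ) + ((μ X).im : ℂ) * Complex.I := (Complex.re_add_im _).symm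
    calc ‖μ X‖ₑ ≤ ‖((μ X).re : ℂ)‖ₑ + ‖((μ X).im : ℂ) * Complex.I‖ₑ := by
          conv_lhs => rw [h]
          exact enorm_add_le _ _
      _ = _ := by
          simp [← ofReal_norm, ComplexMeasure.re, ComplexMeasure.im,
            VectorMeasure.mapRangeₗ]
  have h1 : IsFiniteMeasure (ComplexMeasure.re μ).variation := by
    rw [← SignedMeasure.totalVariation_eq_variation]; infer_instance
  have h2 : IsFiniteMeasure (ComplexMeasure.im μ).variation := by
    rw [← SignedMeasure.totalVariation_eq_variation]; infer_instance
  exact isFiniteMeasure_of_le _ hle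

lemma complexMeasure_integral_smul (μ : ComplexMeasure Ω) (c : ℂ) {f : Ω → ℝ}
    (hf : μ.Integrable f) : ∫ᵛ x, f x ∂•(c • μ) = c * ∫ᵛ x, f x ∂•μ := by
  have h1 := VectorMeasure.continuousLinearMap_apply_integral (μ := μ) (f := f)
    (B := ContinuousLinearMap.lsmul ℝ ℝ) (C := ContinuousLinearMap.mul ℝ ℂ c) hf
  rw [ContinuousLinearMap.mul_apply'] at h1
  have hT : μ.transpose ((ContinuousLinearMap.compL ℝ ℂ ℂ ℂ (ContinuousLinearMap.mul ℝ ℂ c)) ∘L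
      ContinuousLinearMap.lsmul ℝ ℝ) = (c • μ).transpose (ContinuousLinearMap.lsmul ℝ ℝ) := by
    ext X hX
    change c * ((1 : ℝ) • μ X) = (1 : ℝ) • (c * μ X)
    simp
  have hd := dominatedFinMeasAdditive_cbmApplyMeasure (c • μ)
    (ContinuousLinearMap.lsmul ℝ ℝ : ℝ →L[ℝ] ℂ →L[ℝ] ℂ)
  have hd' := dominatedFinMeasAdditive_cbmApplyMeasure μ
    ((ContinuousLinearMap.compL ℝ ℂ ℂ ℂ (ContinuousLinearMap.mul ℝ ℂ c)) ∘L
      ContinuousLinearMap.lsmul ℝ ℝ)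
  have hd'' := hd'
  rw [hT] at hd''
  rw [h1, VectorMeasure.integral_eq_setToFun, VectorMeasure.integral_eq_setToFun,
    setToFun_congr_left hd' hd'' (by rw [hT])]
  symm
  refine setToFun_congr_measure_of_integrable (‖c‖₊ : ENNReal) ENNReal.coe_ne_top ?_ hd'' hd f hf
  rw [VectorMeasure.variation_smul]
  exact le_of_eq rfl

end Measures

/-- The composition `g ∘ f` of unbounded operators, on its natural domain
`{x ∈ D(f) | f x ∈ D(g)}`. -/
def LinearPMap.compNatural {H₁ H₂ H₃ : Type*} [AddCommGroup H₁] [Module ℂ H₁]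
    [AddCommGroup H₂] [Module ℂ H₂] [AddCommGroup H₃] [Module ℂ H₃]
    (g : H₂ →ₗ.[ℂ] H₃) (f : H₁ →ₗ.[ℂ] H₂) : H₁ →ₗ.[ℂ] H₃ where
  domain :=
    { carrier := {x | ∃ hx : x ∈ f.domain, f ⟨x, hx⟩ ∈ g.domain}
      zero_mem' := ⟨f.domain.zero_mem, by
        have : f ⟨0, f.domain.zero_mem⟩ = 0 := f.map_zero
        rw [this]; exact g.domain.zero_mem⟩
      add_mem' := by
        rintro x y ⟨hx, hx'⟩ ⟨hy, hy'⟩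
        refine ⟨f.domain.add_mem hx hy, ?_⟩
        have : f ⟨x + y, f.domain.add_mem hx hy⟩ = f ⟨x, hx⟩ + f ⟨y, hy⟩ :=
          f.map_add ⟨x, hx⟩ ⟨y, hy⟩
        rw [this]; exact g.domain.add_mem hx' hy'
      smul_mem' := by
        rintro c x ⟨hx, hx'⟩
        refine ⟨f.domain.smul_mem c hx, ?_⟩
        have : f ⟨c • x, f.domain.smul_mem c hx⟩ = c • f ⟨x, hx⟩ := f.map_smul c ⟨x, hx⟩
        rw [this]; exact g.domain.smul_mem c hx' }
  toFun :=
    { toFun := fun x => g ⟨f ⟨x, x.2.fst⟩, x.2.snd⟩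
      map_add' := by
        intro x y
        rw [← g.map_add]
        congr 1
        exact Subtype.ext (f.map_add ⟨x, x.2.fst⟩ ⟨y, y.2.fst⟩)
      map_smul' := by
        intro c x
        rw [RingHom.id_apply, ← g.map_smul]
        congr 1
        exact Subtype.ext (f.map_smul c ⟨x, x.2.fst⟩) }

/-- A bounded operator, regarded as an unbounded operator with full domain. -/
def ContinuousLinearMap.toFullPMap {H₁ H₂ : Type*} [NormedAddCommGroup H₁] [NormedSpace ℂ H₁]
    [NormedAddCommGroup H₂] [NormedSpace ℂ H₂] (A : H₁ →L[ℂ] H₂) : H₁ →ₗ.[ℂ] H₂ :=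
  (A : H₁ →ₗ[ℂ] H₂).toPMap ⊤

/-- A positive operator valued measure on a measurable space: a strongly σ-additive map from the
measurable sets to the positive bounded operators on `H`. As for `VectorMeasure`, the function is
extended by `0` to the non-measurable sets, where its value carries no information. -/
structure POVM (Ω : Type*) [MeasurableSpace Ω] (H : Type*) [NormedAddCommGroup H]
    [InnerProductSpace ℂ H] where
  toFun : Set Ω → H →L[ℂ] H
  not_measurable : ∀ X, ¬ MeasurableSet X → toFun X = 0
  isPositive : ∀ X, MeasurableSet X → (toFun X).IsPositive
  hasSum_iUnion : ∀ (φ : H) (X : ℕ → Set Ω), (∀ n, MeasurableSet (X n)) →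
    Pairwise (Disjoint on X) → HasSum (fun n => toFun (X n) φ) (toFun (⋃ n, X n) φ)

namespace POVM

variable {Ω : Type*} [MeasurableSpace Ω] {H : Type*} [NormedAddCommGroup H]
  [InnerProductSpace ℂ H]

/-- A POVM is normalized if `E(Ω) = I`. -/
def IsNormalized (E : POVM Ω H) : Prop := E.toFun Set.univ = ContinuousLinearMap.id ℂ H

/-- A spectral measure: a normalized POVM whose values are orthogonal projections. -/
structure IsSpectral [CompleteSpace H] (E : POVM Ω H) : Prop where
  isNormalized : E.IsNormalized
  isStarProjection : ∀ X, MeasurableSet X → IsStarProjection (E.toFun X)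

/-- `(K, F, V)`, with `K` the Hilbert space of `F`, is a Naimark dilation of `E`: the POVM `F` is a
spectral measure, and `E(X) = V* F(X) V` for all measurable `X`. -/
structure IsNaimarkDilation [CompleteSpace H] {K : Type*} [NormedAddCommGroup K]
    [InnerProductSpace ℂ K] [CompleteSpace K] (E : POVM Ω H) (F : POVM Ω K) (V : H →L[ℂ] K) :
    Prop where
  isSpectral : F.IsSpectral
  eq_compression : ∀ X, MeasurableSet X →
    E.toFun X = (ContinuousLinearMap.adjoint V) ∘L (F.toFun X) ∘L V

lemma toFun_empty (E : POVM Ω H) : E.toFun ∅ = 0 := by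
  ext φ
  have h := E.hasSum_iUnion φ (fun _ => ∅) (fun _ => MeasurableSet.empty)
    (fun _ _ _ => disjoint_bot_left)
  have h1 := tendsto_nhds_unique h.summable.tendsto_atTop_zero tendsto_const_nhds
  simpa using h1.symm

/-- The complex measure `E_{ψ,φ} : X ↦ ⟪ψ, E(X) φ⟫`. -/
def sesq (E : POVM Ω H) (ψ φ : H) : ComplexMeasure Ω where
  measureOf' X := ⟪ψ, E.toFun X φ⟫_ℂ
  empty' := by simp [E.toFun_empty]
  not_measurable' X hX := by simp [E.not_measurable X hX]
  m_iUnion' X hX hd := (E.hasSum_iUnion φ X hX hd).mapL (innerSL ℂ ψ)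

lemma sesq_apply (E : POVM Ω H) (ψ φ : H) (X : Set Ω) :
    E.sesq ψ φ X = ⟪ψ, E.toFun X φ⟫_ℂ := rfl

lemma sesq_add_left (E : POVM Ω H) (ψ₁ ψ₂ φ : H) :
    E.sesq (ψ₁ + ψ₂) φ = E.sesq ψ₁ φ + E.sesq ψ₂ φ := by
  ext X _; simp [sesq_apply]

lemma sesq_add_right (E : POVM Ω H) (ψ φ₁ φ₂ : H) :
    E.sesq ψ (φ₁ + φ₂) = E.sesq ψ φ₁ + E.sesq ψ φ₂ := by
  ext X _; simp [sesq_apply]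

lemma sesq_smul_left (E : POVM Ω H) (c : ℂ) (ψ φ : H) :
    E.sesq (c • ψ) φ = conj c • E.sesq ψ φ := by
  ext X _; simp [sesq_apply, mul_comm]

lemma sesq_smul_right (E : POVM Ω H) (c : ℂ) (ψ φ : H) :
    E.sesq ψ (c • φ) = c • E.sesq ψ φ := by
  ext X _; simp [sesq_apply]

lemma integrable_smul {μ : ComplexMeasure Ω} (c : ℂ) {f : Ω → ℝ} (hf : μ.Integrable f) :
    (c • μ).Integrable f := by
  unfold VectorMeasure.Integrable
  rw [VectorMeasure.variation_smul]
  exact Integrable.smul_measure_nnreal hf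

lemma integrable_add {μ ν : ComplexMeasure Ω} {f : Ω → ℝ} (hμ : μ.Integrable f)
    (hν : ν.Integrable f) : (μ + ν).Integrable f :=
  VectorMeasure.Integrable.add_vectorMeasure hμ hν

lemma norm_inner_le (E : POVM Ω H) (ψ φ : H) {X : Set Ω} (hX : MeasurableSet X) (c : ℝ) :
    c * ‖⟪ψ, E.toFun X φ⟫_ℂ‖ ≤
      (c ^ 2 * ‖⟪φ, E.toFun X φ⟫_ℂ‖ + ‖⟪ψ, E.toFun X ψ⟫_ℂ‖) / 2 := by
  have hT := E.isPositive X hX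
  set T := E.toFun X
  obtain ⟨u, hu, hu'⟩ := RCLike.exists_norm_eq_mul_self ⟪ψ, T φ⟫_ℂ
  have h0 := hT.re_inner_nonneg_right (((c : ℂ) * u) • φ - ψ)
  have hsym : ⟪φ, T ψ⟫_ℂ = conj ⟪ψ, T φ⟫_ℂ := by
    rw [inner_conj_symm, hT.inner_left_eq_inner_right]
  have huu : conj u * u = 1 := by
    rw [Complex.conj_mul', hu]; simp
  have e : ⟪((c : ℂ) * u) • φ - ψ, T (((c : ℂ) * u) • φ - ψ)⟫_ℂ
      = (c : ℂ) ^ 2 * ⟪φ, T φ⟫_ℂ + ⟪ψ, T ψ⟫_ℂ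
        - ((c * (u * ⟪ψ, T φ⟫_ℂ) + conj (c * (u * ⟪ψ, T φ⟫_ℂ)))) := by
    simp only [map_sub, map_smul, inner_sub_left, inner_sub_right, inner_smul_left,
      inner_smul_right, map_mul, Complex.conj_ofReal, hsym]
    linear_combination (c : ℂ) ^ 2 * ⟪φ, T φ⟫_ℂ * huu
  rw [e, ← hu'] at h0
  have e2 : RCLike.re ((c : ℂ) ^ 2 * ⟪φ, T φ⟫_ℂ + ⟪ψ, T ψ⟫_ℂ
        - ((c * ((‖⟪ψ, T φ⟫_ℂ‖ : ℝ) : ℂ) + conj (c * ((‖⟪ψ, T φ⟫_ℂ‖ : ℝ) : ℂ)))))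
      = c ^ 2 * (⟪φ, T φ⟫_ℂ).re + (⟪ψ, T ψ⟫_ℂ).re - 2 * (c * ‖⟪ψ, T φ⟫_ℂ‖) := by
    simp [← Complex.ofReal_pow]
    ring
  have h1 := e2 ▸ h0
  have h2 := Complex.re_le_norm ⟪φ, T φ⟫_ℂ
  have h3 := Complex.re_le_norm ⟪ψ, T ψ⟫_ℂ
  nlinarith [mul_le_mul_of_nonneg_left h2 (sq_nonneg c)]

lemma variation_sesq_le (E : POVM Ω H) (ψ φ : H) :
    (E.sesq ψ φ).variation ≤ (E.sesq φ φ).variation + (E.sesq ψ ψ).variation := by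
  refine VectorMeasure.variation_le_of_forall_enorm_le fun X hX => ?_
  refine le_trans ?_ (add_le_add (VectorMeasure.enorm_measure_le_variation _ X)
    (VectorMeasure.enorm_measure_le_variation _ X))
  have h := E.norm_inner_le ψ φ hX 1
  simp only [sesq_apply, ← ofReal_norm]
  rw [← ENNReal.ofReal_add (norm_nonneg _) (norm_nonneg _)]
  refine ENNReal.ofReal_le_ofReal ?_
  nlinarith [norm_nonneg ⟪φ, E.toFun X φ⟫_ℂ, norm_nonneg ⟪ψ, E.toFun X ψ⟫_ℂ]

lemma integrable_sesq (E : POVM Ω H) {ψ φ : H} {f : Ω → ℝ} (hψ : (E.sesq ψ ψ).Integrable f)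
    (hφ : (E.sesq φ φ).Integrable f) : (E.sesq ψ φ).Integrable f :=
  Integrable.mono_measure (Integrable.add_measure hφ hψ) (E.variation_sesq_le ψ φ)

/-- The form domain `D_F(f, E) = {φ | ∫ |f| dE_{φ,φ} < ∞}`. -/
def formDomain (E : POVM Ω H) (f : Ω → ℝ) : Submodule ℂ H where
  carrier := {φ | (E.sesq φ φ).Integrable f}
  zero_mem' := by
    have : E.sesq 0 0 = 0 := by ext X _; simp [sesq_apply]
    simp [this, VectorMeasure.Integrable]
  add_mem' := by
    intro φ ψ hφ hψ
    simp only [Set.mem_ofPred_eq, sesq_add_left, sesq_add_right] at hφ hψ ⊢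
    exact integrable_add (integrable_add hφ (E.integrable_sesq hψ hφ))
      (integrable_add (E.integrable_sesq hφ hψ) hψ)
  smul_mem' := by
    intro c φ hφ
    simp only [Set.mem_ofPred_eq, sesq_smul_left, sesq_smul_right] at hφ ⊢
    exact integrable_smul _ (integrable_smul _ hφ)

/-- `D(f, E) = {φ | ∫ |f| d|E_{ψ,φ}| < ∞ for all ψ ∈ H}`, the domain of the strong operator
integral, where `|E_{ψ,φ}|` is the total variation of `E_{ψ,φ}`. -/
def strongDomain (E : POVM Ω H) (f : Ω → ℝ) : Submodule ℂ H where
  carrier := {φ | ∀ ψ, (E.sesq ψ φ).Integrable f}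
  zero_mem' := by
    intro ψ
    have : E.sesq ψ 0 = 0 := by ext X _; simp [sesq_apply]
    simp [this, VectorMeasure.Integrable]
  add_mem' := by
    intro φ₁ φ₂ h₁ h₂ ψ
    rw [sesq_add_right]
    exact integrable_add (h₁ ψ) (h₂ ψ)
  smul_mem' := by
    intro c φ hφ ψ
    rw [sesq_smul_right]
    exact integrable_smul _ (hφ ψ)

/-- The square integrability domain `{φ | ∫ |f|² dE_{φ,φ} < ∞}`. -/
def sqDomain (E : POVM Ω H) (f : Ω → ℝ) : Submodule ℂ H :=
  E.formDomain fun x => f x ^ 2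

lemma sqDomain_le_strongDomain (E : POVM Ω H) {f : Ω → ℝ} (hf : Measurable f) :
    E.sqDomain f ≤ E.strongDomain f := by
  intro φ hφ ψ
  refine ⟨hf.aestronglyMeasurable, ?_⟩
  have hfin := complexMeasure_isFiniteMeasure_variation (E.sesq ψ ψ)
  have hsq : ∫⁻ x, ‖f x‖ₑ ^ 2 ∂(E.sesq φ φ).variation < ⊤ := by
    have h2 := (show (E.sesq φ φ).Integrable fun x => f x ^ 2 from hφ).2
    simpa [HasFiniteIntegral, enorm_pow] using h2
  have key : ∀ (t : NNReal) (X : Set Ω), MeasurableSet X →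
      (t : ENNReal) * (E.sesq ψ φ).variation X ≤
        (t : ENNReal) ^ 2 * (E.sesq φ φ).variation X + (E.sesq ψ ψ).variation X := by
    intro t X hX
    have := E.variation_sesq_le ψ ((t : ℂ) • φ)
    have h := this X
    rw [sesq_smul_right, sesq_smul_right, sesq_smul_left, VectorMeasure.variation_smul,
      VectorMeasure.variation_smul, VectorMeasure.variation_smul] at h
    have ht : ‖(t : ℂ)‖₊ = t := by simp
    have ht' : ‖conj (t : ℂ)‖₊ = t := by rw [RCLike.nnnorm_conj, ht]
    rw [ht', ht] at h
    have h' : (t : ENNReal) * (E.sesq ψ φ).variation X ≤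
        (t : ENNReal) * ((t : ENNReal) * (E.sesq φ φ).variation X) +
          (E.sesq ψ ψ).variation X := h
    rwa [← mul_assoc, ← sq] at h'
  have bound : ∫⁻ x, ‖f x‖ₑ ∂(E.sesq ψ φ).variation ≤
      ∫⁻ x, ‖f x‖ₑ ^ 2 ∂(E.sesq φ φ).variation + (E.sesq ψ ψ).variation Set.univ := by
    have e : ∀ x, ‖f x‖ₑ = ((‖f x‖₊ : NNReal) : ENNReal) := fun x => rfl
    simp only [e]
    rw [lintegral_eq_nnreal]
    refine iSup₂_le fun g hg => ?_
    have h1 : ∫⁻ x, (g x : ENNReal) ^ 2 ∂(E.sesq φ φ).variation ≤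
        ∫⁻ x, ((‖f x‖₊ : NNReal) : ENNReal) ^ 2 ∂(E.sesq φ φ).variation :=
      lintegral_mono fun x => pow_le_pow_left' (hg x) 2
    refine le_trans ?_ (add_le_add_left h1 _)
    have h2 : ∫⁻ x, (g x : ENNReal) ^ 2 ∂(E.sesq φ φ).variation
        = ∑ c ∈ g.range, (c : ENNReal) ^ 2 * (E.sesq φ φ).variation (g ⁻¹' {c}) := by
      have := SimpleFunc.lintegral_eq_lintegral (g.map fun c : NNReal => (c : ENNReal) ^ 2)
        (E.sesq φ φ).variation
      rw [SimpleFunc.map_lintegral] at this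
      simpa using this
    rw [h2, SimpleFunc.map_lintegral, ← SimpleFunc.sum_range_measure_preimage_singleton g
      (E.sesq ψ ψ).variation, ← Finset.sum_add_distrib]
    exact Finset.sum_le_sum fun c _ => key c _ (g.measurableSet_fiber c)
  exact lt_of_le_of_lt bound (ENNReal.add_lt_top.2 ⟨hsq, measure_lt_top _ _⟩)

lemma integral_add_left (E : POVM Ω H) {ψ₁ ψ₂ φ : H} {f : Ω → ℝ}
    (h₁ : (E.sesq ψ₁ φ).Integrable f) (h₂ : (E.sesq ψ₂ φ).Integrable f) :
    ∫ᵛ x, f x ∂•(E.sesq (ψ₁ + ψ₂) φ) =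
      ∫ᵛ x, f x ∂•(E.sesq ψ₁ φ) + ∫ᵛ x, f x ∂•(E.sesq ψ₂ φ) := by
  rw [sesq_add_left, VectorMeasure.integral_add_vectorMeasure h₁ h₂]

lemma integral_add_right (E : POVM Ω H) {ψ φ₁ φ₂ : H} {f : Ω → ℝ}
    (h₁ : (E.sesq ψ φ₁).Integrable f) (h₂ : (E.sesq ψ φ₂).Integrable f) :
    ∫ᵛ x, f x ∂•(E.sesq ψ (φ₁ + φ₂)) =
      ∫ᵛ x, f x ∂•(E.sesq ψ φ₁) + ∫ᵛ x, f x ∂•(E.sesq ψ φ₂) := by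
  rw [sesq_add_right, VectorMeasure.integral_add_vectorMeasure h₁ h₂]

lemma integral_smul_left (E : POVM Ω H) (c : ℂ) {ψ φ : H} {f : Ω → ℝ}
    (h : (E.sesq ψ φ).Integrable f) :
    ∫ᵛ x, f x ∂•(E.sesq (c • ψ) φ) = conj c * ∫ᵛ x, f x ∂•(E.sesq ψ φ) := by
  rw [sesq_smul_left, complexMeasure_integral_smul _ _ h]

lemma integral_smul_right (E : POVM Ω H) (c : ℂ) {ψ φ : H} {f : Ω → ℝ}
    (h : (E.sesq ψ φ).Integrable f) :
    ∫ᵛ x, f x ∂•(E.sesq ψ (c • φ)) = c * ∫ᵛ x, f x ∂•(E.sesq ψ φ) := by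
  rw [sesq_smul_right, complexMeasure_integral_smul _ _ h]

/-- The Riesz representation: a continuous functional `ψ ↦ ∫ f dE_{ψ,φ}` on a subspace is given by
a vector. -/
lemma exists_inner_eq_integral [CompleteSpace H] (E : POVM Ω H) {f : Ω → ℝ} {φ : H}
    (D : Submodule ℂ H) (hD : ∀ ψ ∈ D, (E.sesq ψ φ).Integrable f)
    (hc : Continuous fun ψ : D => ∫ᵛ x, f x ∂•(E.sesq (ψ : H) φ)) :
    ∃ v : H, ∀ ψ ∈ D, ⟪ψ, v⟫_ℂ = ∫ᵛ x, f x ∂•(E.sesq ψ φ) := by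
  let l : StrongDual ℂ D :=
    { toFun := fun ψ => conj (∫ᵛ x, f x ∂•(E.sesq (ψ : H) φ))
      map_add' := fun a b => by
        rw [Submodule.coe_add, E.integral_add_left (hD a a.2) (hD b b.2), map_add]
      map_smul' := fun c a => by
        rw [Submodule.coe_smul, E.integral_smul_left c (hD a a.2), map_mul, Complex.conj_conj]
        rfl
      cont := Complex.continuous_conj.comp hc }
  obtain ⟨L, hL, -⟩ := exists_extension_norm_eq D l
  refine ⟨(InnerProductSpace.toDual ℂ H).symm L, fun ψ hψ => ?_⟩
  have h1 : L ψ = conj (∫ᵛ x, f x ∂•(E.sesq ψ φ)) := hL ⟨ψ, hψ⟩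
  rw [← inner_conj_symm, InnerProductSpace.toDual_symm_apply, h1, Complex.conj_conj]

lemma continuous_integral_simpleFunc (E : POVM Ω H) (φ : H) (s : SimpleFunc Ω ℝ) :
    Continuous fun ψ : H => ∫ᵛ x, s x ∂•(E.sesq ψ φ) := by
  have hfin : ∀ ψ, IsFiniteMeasure (E.sesq ψ φ).variation := fun ψ =>
    complexMeasure_isFiniteMeasure_variation _
  induction s using SimpleFunc.induction with
  | const c hs =>
    rename_i X
    have : ∀ ψ, ∫ᵛ x, (SimpleFunc.piecewise X hs (SimpleFunc.const Ω c)
        (SimpleFunc.const Ω 0)) x ∂•(E.sesq ψ φ) = (c : ℂ) * ⟪ψ, E.toFun X φ⟫_ℂ := by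
      intro ψ
      have h := VectorMeasure.integral_indicator_const (μ := E.sesq ψ φ)
        (B := ContinuousLinearMap.lsmul ℝ ℝ) c hs
      simp only [ContinuousLinearMap.lsmul_apply, sesq_apply] at h
      rw [show (fun x => (SimpleFunc.piecewise X hs (SimpleFunc.const Ω c)
        (SimpleFunc.const Ω 0)) x) = X.indicator fun _ => c from by
          ext x; simp [Set.indicator, Set.piecewise]]
      simpa using h
    simp only [this]
    fun_prop
  | add hd h₁ h₂ =>
    rename_i f g
    have : ∀ ψ, ∫ᵛ x, (f + g) x ∂•(E.sesq ψ φ) =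
        ∫ᵛ x, f x ∂•(E.sesq ψ φ) + ∫ᵛ x, g x ∂•(E.sesq ψ φ) := fun ψ =>
      VectorMeasure.integral_fun_add (f.integrable_of_isFiniteMeasure)
        (g.integrable_of_isFiniteMeasure)
    simp only [this]
    exact h₁.add h₂

lemma continuous_integral_of_mem_strongDomain [CompleteSpace H] (E : POVM Ω H) {f : Ω → ℝ}
    (hf : Measurable f) {φ : H} (hφ : φ ∈ E.strongDomain f) :
    Continuous fun ψ : H => ∫ᵛ x, f x ∂•(E.sesq ψ φ) := by
  have hfin : ∀ ψ, IsFiniteMeasure (E.sesq ψ φ).variation := fun ψ =>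
    complexMeasure_isFiniteMeasure_variation _
  let s : ℕ → SimpleFunc Ω ℝ := SimpleFunc.approxOn f hf Set.univ 0 (Set.mem_univ _)
  let l : ℕ → H →L[ℂ] ℂ := fun n =>
    { toFun := fun ψ => conj (∫ᵛ x, s n x ∂•(E.sesq ψ φ))
      map_add' := fun a b => by
        rw [E.integral_add_left ((s n).integrable_of_isFiniteMeasure)
          ((s n).integrable_of_isFiniteMeasure), map_add]
      map_smul' := fun c a => by
        rw [E.integral_smul_left c ((s n).integrable_of_isFiniteMeasure), map_mul,
          Complex.conj_conj]
        rfl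
      cont := Complex.continuous_conj.comp (E.continuous_integral_simpleFunc φ (s n)) }
  have hl : Tendsto (fun n ψ => l n ψ) atTop
      (𝓝 fun ψ : H => conj (∫ᵛ x, f x ∂•(E.sesq ψ φ))) := by
    rw [tendsto_pi_nhds]
    intro ψ
    refine (Complex.continuous_conj.tendsto _).comp ?_
    refine VectorMeasure.tendsto_integral_of_dominated_convergence (fun x => ‖f x‖ + ‖f x‖)
      (fun n => (s n).stronglyMeasurable.aestronglyMeasurable) ((hφ ψ).norm.add (hφ ψ).norm)
      (fun n => Eventually.of_forall fun x =>
        SimpleFunc.norm_approxOn_zero_le hf (Set.mem_univ _) x n)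
      (Eventually.of_forall fun x => SimpleFunc.tendsto_approxOn hf (Set.mem_univ _) (by simp))
  have hcont := (continuousLinearMapOfTendsto (σ₁₂ := RingHom.id ℂ) l hl).continuous
  have h2 := Complex.continuous_conj.comp hcont
  refine h2.congr fun ψ => ?_
  exact Complex.conj_conj _

/-- The (maximal) strong operator integral `L(f, E)`: its domain is `D(f, E)`, and `L(f, E) φ` is
the vector with `⟪ψ, L(f, E) φ⟫ = ∫ f dE_{ψ,φ}` for all `ψ ∈ H`, i.e. the integral of `f` with
respect to the vector measure `X ↦ E(X) φ`. -/
def strongOp [CompleteSpace H] (E : POVM Ω H) (f : Ω → ℝ) (hf : Measurable f) : H →ₗ.[ℂ] H :=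
  have ex : ∀ φ : E.strongDomain f, ∃ v : H, ∀ ψ, ⟪ψ, v⟫_ℂ = ∫ᵛ x, f x ∂•(E.sesq ψ φ) := by
    intro φ
    obtain ⟨v, hv⟩ := E.exists_inner_eq_integral (⊤ : Submodule ℂ H) (fun ψ _ => φ.2 ψ)
      ((E.continuous_integral_of_mem_strongDomain hf φ.2).comp continuous_subtype_val)
    exact ⟨v, fun ψ => hv ψ Submodule.mem_top⟩
  { domain := E.strongDomain f
    toFun :=
      { toFun := fun φ => (ex φ).choose
        map_add' := fun a b => by
          refine ext_inner_left ℂ fun ψ => ?_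
          rw [inner_add_right, (ex _).choose_spec, (ex _).choose_spec, (ex _).choose_spec,
            Submodule.coe_add, E.integral_add_right (a.2 ψ) (b.2 ψ)]
        map_smul' := fun c a => by
          refine ext_inner_left ℂ fun ψ => ?_
          rw [RingHom.id_apply, inner_smul_right, (ex _).choose_spec, (ex _).choose_spec,
            Submodule.coe_smul, E.integral_smul_right c (a.2 ψ)] } }

lemma inner_strongOp [CompleteSpace H] (E : POVM Ω H) (f : Ω → ℝ) (hf : Measurable f)
    (φ : (E.strongOp f hf).domain) (ψ : H) :
    ⟪ψ, E.strongOp f hf φ⟫_ℂ = ∫ᵛ x, f x ∂•(E.sesq ψ φ) := by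
  have ex : ∃ v : H, ∀ ψ, ⟪ψ, v⟫_ℂ = ∫ᵛ x, f x ∂•(E.sesq ψ (φ : H)) := by
    obtain ⟨v, hv⟩ := E.exists_inner_eq_integral (⊤ : Submodule ℂ H)
      (fun ψ _ => (show (φ : H) ∈ E.strongDomain f from φ.2) ψ)
      ((E.continuous_integral_of_mem_strongDomain hf φ.2).comp continuous_subtype_val)
    exact ⟨v, fun ψ => hv ψ Submodule.mem_top⟩
  exact ex.choose_spec ψ

/-- The strong operator integral `L̃(f, E)` on the square integrability domain: the restriction of
`L(f, E)` to `{φ | ∫ |f|² dE_{φ,φ} < ∞}`. -/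
def sqOp [CompleteSpace H] (E : POVM Ω H) (f : Ω → ℝ) (hf : Measurable f) : H →ₗ.[ℂ] H where
  domain := E.sqDomain f
  toFun := (E.strongOp f hf).toFun ∘ₗ
    Submodule.inclusion (E.sqDomain_le_strongDomain hf)

/-- The domain `{φ ∈ D_F(f, E) | D_F(f, E) ∋ ψ ↦ ∫ f dE_{ψ,φ} is continuous}` of the largest
symmetric weak operator integral. -/
def weakDomain (E : POVM Ω H) (f : Ω → ℝ) : Submodule ℂ H where
  carrier := {φ | φ ∈ E.formDomain f ∧
    Continuous fun ψ : E.formDomain f => ∫ᵛ x, f x ∂•(E.sesq (ψ : H) φ)}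
  zero_mem' := by
    refine ⟨zero_mem _, ?_⟩
    have : ∀ ψ : H, E.sesq ψ 0 = 0 := fun ψ => by ext X _; simp [sesq_apply]
    simp only [this, VectorMeasure.integral_zero_vectorMeasure]
    exact continuous_const
  add_mem' := by
    rintro a b ⟨ha, ha'⟩ ⟨hb, hb'⟩
    refine ⟨add_mem ha hb, (ha'.add hb').congr fun ψ => ?_⟩
    exact (E.integral_add_right (E.integrable_sesq ψ.2 ha) (E.integrable_sesq ψ.2 hb)).symm
  smul_mem' := by
    rintro c a ⟨ha, ha'⟩
    refine ⟨Submodule.smul_mem _ c ha, ((continuous_const (y := c)).mul ha').congr fun ψ => ?_⟩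
    exact (E.integral_smul_right c (E.integrable_sesq ψ.2 ha)).symm

open Classical in
/-- The largest symmetric weak operator integral `L'(f, E)`, meaningful when the form domain
`D_F(f, E)` is dense (otherwise the value is the junk value `0`): for `φ` in its domain,
`L'(f, E) φ` is the vector with `⟪ψ, L'(f, E) φ⟫ = ∫ f dE_{ψ,φ}` for all `ψ ∈ D_F(f, E)`. -/
def weakOp [CompleteSpace H] (E : POVM Ω H) (f : Ω → ℝ) : H →ₗ.[ℂ] H where
  domain := E.weakDomain f
  toFun :=
    have ex : ∀ φ : E.weakDomain f, ∃ v : H, ∀ ψ ∈ E.formDomain f,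
        ⟪ψ, v⟫_ℂ = ∫ᵛ x, f x ∂•(E.sesq ψ φ) := fun φ =>
      E.exists_inner_eq_integral _ (fun ψ hψ => E.integrable_sesq hψ φ.2.1) φ.2.2
    if hD : Dense (E.formDomain f : Set H) then
      { toFun := fun φ => (ex φ).choose
        map_add' := fun a b => by
          refine hD.eq_of_inner_right ℂ fun ψ hψ => ?_
          rw [inner_add_right, (ex _).choose_spec ψ hψ, (ex _).choose_spec ψ hψ,
            (ex _).choose_spec ψ hψ, Submodule.coe_add,
            E.integral_add_right (E.integrable_sesq hψ a.2.1) (E.integrable_sesq hψ b.2.1)]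
        map_smul' := fun c a => by
          refine hD.eq_of_inner_right ℂ fun ψ hψ => ?_
          rw [RingHom.id_apply, inner_smul_right, (ex _).choose_spec ψ hψ,
            (ex _).choose_spec ψ hψ, Submodule.coe_smul,
            E.integral_smul_right c (E.integrable_sesq hψ a.2.1)] }
    else 0

lemma inner_weakOp [CompleteSpace H] (E : POVM Ω H) (f : Ω → ℝ)
    (hD : Dense (E.formDomain f : Set H)) (φ : (E.weakOp f).domain) {ψ : H}
    (hψ : ψ ∈ E.formDomain f) :
    ⟪ψ, E.weakOp f φ⟫_ℂ = ∫ᵛ x, f x ∂•(E.sesq ψ φ) := by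
  have ex : ∃ v : H, ∀ ψ ∈ E.formDomain f, ⟪ψ, v⟫_ℂ = ∫ᵛ x, f x ∂•(E.sesq ψ (φ : H)) :=
    E.exists_inner_eq_integral _ (fun ψ hψ => E.integrable_sesq hψ φ.2.1) φ.2.2
  have h := ex.choose_spec ψ hψ
  have e : (E.weakOp f).toFun = _ := dif_pos hD
  change ⟪ψ, (E.weakOp f).toFun φ⟫_ℂ = _
  rw [e]
  exact h

/-- The moment operator `E[k] = L(x^k, E)`. -/
def strongMoment [CompleteSpace H] (E : POVM ℝ H) (k : ℕ) : H →ₗ.[ℂ] H :=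
  E.strongOp (fun x => x ^ k) (measurable_id.pow_const k)

/-- The moment operator `Ẽ[k] = L̃(x^k, E)`. -/
def sqMoment [CompleteSpace H] (E : POVM ℝ H) (k : ℕ) : H →ₗ.[ℂ] H :=
  E.sqOp (fun x => x ^ k) (measurable_id.pow_const k)

/-- The moment operator `E'[k] = L'(x^k, E)`. -/
def weakMoment [CompleteSpace H] (E : POVM ℝ H) (k : ℕ) : H →ₗ.[ℂ] H :=
  E.weakOp (fun x => x ^ k)

end POVM

end

/-! Write f for x^j and L for the self-adjoint-type integral `F.strongOp f` of the spectral measure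
F. For a spectral measure, multiplicativity forces E_{Lφ,φ} = f·E_{φ,φ} and E_{Lφ,Lφ} = f²·E_{φ,φ}.
Three facts follow: D(L) is exactly the square integrability domain (`strongDomain_le_sqDomain`),
⟪Lψ, Lφ⟫ = ∫ f² dF_{ψ,φ} (`inner_strongOp_strongOp`), and Lφ ∈ D(L) makes f⁴ integrable
(`mem_sqDomain_sq`).

The dilation gives E_{ψ,φ} = F_{Vψ,Vφ}, so the form ∫ f² dE_{ψ,φ} becomes ⟪LVψ, LVφ⟫ on the common
domain of all ψ with Vψ ∈ D(L). The weak domain of f² then consists of the φ for which ψ ↦ ⟪LVψ,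
LVφ⟫ is continuous.

(a) This continuity says LVφ ∈ D((LV)*). If (LV)* = V*L, then LVφ ∈ D(L), so f⁴ is
E_{φ,φ}-integrable, which is the nontrivial domain inclusion.

(b) If L preserves the range of the isometry V, then LVφ = VV*LVφ, and V*LV is the square
integrability operator S of f. The form becomes ⟪Sψ, Sφ⟫, whose continuity in ψ says Sφ ∈ D(S*). -/

/-! ### Complex measures with a density. -/

/-- Integration against a complex measure with a density with respect to a positive measure. -/
lemma MeasureTheory.Measure.integral_withDensityᵥ {Ω : Type*} [MeasurableSpace Ω]
    {ρ : Measure Ω} {h : Ω → ℂ} (hh : Integrable h ρ) {f : Ω → ℝ} (hf : Measurable f)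
    (hfi : VectorMeasure.Integrable (ρ.withDensityᵥ h) f) :
    ∫ᵛ x, f x ∂•(ρ.withDensityᵥ h) = ∫ x, (f x : ℂ) * h x ∂ρ := by
  have hvar : (ρ.withDensityᵥ h).variation = ρ.withDensity fun x => ‖h x‖ₑ :=
    Measure.variation_withDensityᵥ hh
  have hfin : IsFiniteMeasure (ρ.withDensityᵥ h).variation :=
    complexMeasure_isFiniteMeasure_variation _
  -- The variation of h·ρ is |h|·ρ, so the hypothesis on f yields the dominating function |f||h| for
  -- the limit on the right-hand side.
  have hfh : Integrable (fun x => ‖f x‖ * ‖h x‖) ρ := by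
    have h1 := hfi
    unfold VectorMeasure.Integrable at h1
    rw [hvar] at h1
    have h2 := (integrable_withDensity_iff_integrable_smul₀' (f := fun x => ‖h x‖ₑ)
      hh.aestronglyMeasurable.enorm (ae_of_all _ fun x => enorm_lt_top)).1 h1
    refine h2.norm.congr (ae_of_all _ fun x => ?_)
    simp [mul_comm]
  let s : ℕ → SimpleFunc Ω ℝ := SimpleFunc.approxOn f hf Set.univ 0 (Set.mem_univ _)
  -- Both sides agree on simple functions; dominated convergence along the same approximants then
  -- gives f. The bound |f| + |f| is the one available for `approxOn` with base point 0.
  have hs : ∀ g : SimpleFunc Ω ℝ, ∫ᵛ x, g x ∂•(ρ.withDensityᵥ h) = ∫ x, (g x : ℂ) * h x ∂ρ := by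
    intro g
    induction g using SimpleFunc.induction with
    | const c hX =>
      rename_i X
      have e : (fun x => (SimpleFunc.piecewise X hX (SimpleFunc.const Ω c)
          (SimpleFunc.const Ω 0)) x) = X.indicator fun _ => c := by
        ext x; simp [Set.indicator, Set.piecewise]
      have e' : (fun x => (((SimpleFunc.piecewise X hX (SimpleFunc.const Ω c)
          (SimpleFunc.const Ω 0)) x : ℝ) : ℂ) * h x) = X.indicator fun x => (c : ℂ) * h x := by
        ext x; by_cases hx : x ∈ X <;> simp [hx]
      rw [e, e', integral_indicator hX, integral_const_mul]
      have := VectorMeasure.integral_indicator_const (μ := ρ.withDensityᵥ h)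
        (B := ContinuousLinearMap.lsmul ℝ ℝ) c hX
      rw [this, withDensityᵥ_apply hh hX]
      simp
    | add hd h₁ h₂ =>
      rename_i g₁ g₂
      have hb : ∀ g : SimpleFunc Ω ℝ, Integrable (fun x => (g x : ℂ) * h x) ρ := fun g => by
        obtain ⟨C, hC⟩ := g.exists_forall_norm_le
        exact hh.bdd_mul (c := C)
          (Complex.measurable_ofReal.comp g.measurable).aestronglyMeasurable
          (ae_of_all _ fun x => by simpa using hC x)
      have e₁ : ∫ᵛ x, (g₁ + g₂) x ∂•(ρ.withDensityᵥ h) =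
          ∫ᵛ x, g₁ x ∂•(ρ.withDensityᵥ h) + ∫ᵛ x, g₂ x ∂•(ρ.withDensityᵥ h) :=
        VectorMeasure.integral_fun_add (g₁.integrable_of_isFiniteMeasure)
          (g₂.integrable_of_isFiniteMeasure)
      rw [e₁, h₁, h₂, ← integral_add (hb g₁) (hb g₂)]
      refine integral_congr_ae (ae_of_all _ fun x => ?_)
      simp [add_mul]
  have hl₁ : Tendsto (fun n => ∫ᵛ x, s n x ∂•(ρ.withDensityᵥ h)) atTop
      (𝓝 (∫ᵛ x, f x ∂•(ρ.withDensityᵥ h))) :=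
    VectorMeasure.tendsto_integral_of_dominated_convergence (fun x => ‖f x‖ + ‖f x‖)
      (fun n => (s n).stronglyMeasurable.aestronglyMeasurable) (hfi.norm.add hfi.norm)
      (fun n => Eventually.of_forall fun x =>
        SimpleFunc.norm_approxOn_zero_le hf (Set.mem_univ _) x n)
      (Eventually.of_forall fun x => SimpleFunc.tendsto_approxOn hf (Set.mem_univ _) (by simp))
  have hl₂ : Tendsto (fun n => ∫ x, (s n x : ℂ) * h x ∂ρ) atTop
      (𝓝 (∫ x, (f x : ℂ) * h x ∂ρ)) := by
    refine tendsto_integral_of_dominated_convergence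
      (fun x => ‖f x‖ * ‖h x‖ + ‖f x‖ * ‖h x‖)
      (fun n => ((Complex.measurable_ofReal.comp (s n).measurable).aestronglyMeasurable).mul
        hh.aestronglyMeasurable) (hfh.add hfh) (fun n => ae_of_all _ fun x => ?_)
      (ae_of_all _ fun x => ?_)
    · rw [norm_mul, ← add_mul, Complex.norm_real]
      exact mul_le_mul_of_nonneg_right
        (SimpleFunc.norm_approxOn_zero_le hf (Set.mem_univ _) x n) (norm_nonneg _)
    · exact ((Complex.continuous_ofReal.tendsto _).comp
        (SimpleFunc.tendsto_approxOn hf (Set.mem_univ _) (by simp))).mul_const _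
  simp only [hs] at hl₁
  exact tendsto_nhds_unique hl₁ hl₂

/-- The variation of h·ρ is |h|·ρ. With h = f or h = f² this converts integrability against E_{Lφ,φ}
or E_{Lφ,Lφ} into integrability of a higher power of f. -/
lemma MeasureTheory.Measure.integrable_withDensityᵥ_iff {Ω : Type*} [MeasurableSpace Ω]
    {ρ : Measure Ω} {h : Ω → ℂ} (hh : Integrable h ρ) {f : Ω → ℝ} :
    VectorMeasure.Integrable (ρ.withDensityᵥ h) f ↔ Integrable (fun x => ‖h x‖ * f x) ρ := by
  unfold VectorMeasure.Integrable
  rw [Measure.variation_withDensityᵥ hh,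
    integrable_withDensity_iff_integrable_smul₀' (f := fun x => ‖h x‖ₑ)
      hh.aestronglyMeasurable.enorm (ae_of_all _ fun x => enorm_lt_top)]
  simp

/-! ### Positivity of E_{φ,φ} and multiplicativity of spectral measures. -/

namespace POVM

variable {Ω : Type*} [MeasurableSpace Ω] {H : Type*} [NormedAddCommGroup H]
  [InnerProductSpace ℂ H]

instance isFiniteMeasure_variation_sesq (E : POVM Ω H) (ψ φ : H) :
    IsFiniteMeasure (E.sesq ψ φ).variation :=
  complexMeasure_isFiniteMeasure_variation _

/-- The measure `E_{φ,φ}` is positive: it agrees with its total variation. -/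
lemma sesq_self_eq (E : POVM Ω H) (φ : H) :
    E.sesq φ φ = (E.sesq φ φ).variation.withDensityᵥ fun _ => (1 : ℂ) := by
  -- Positivity of E(X) makes E_{φ,φ} real and nonnegative, so its real part is a signed measure
  -- that comes from a positive measure ρ.
  let s : SignedMeasure Ω := ComplexMeasure.re (E.sesq φ φ)
  have hs : ∀ X, MeasurableSet X → (s X : ℂ) = E.sesq φ φ X ∧ 0 ≤ s X := fun X hX => by
    have h := (E.isPositive X hX).inner_nonneg_right φ
    have h' := Complex.le_def.1 h
    refine ⟨?_, h'.1⟩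
    exact Complex.ext rfl h'.2
  have h0 : 0 ≤[Set.univ] s :=
    VectorMeasure.restrict_le_restrict_of_subset_le _ _ fun X hX _ => (hs X hX).2
  let ρ := s.toMeasureOfZeroLE Set.univ MeasurableSet.univ h0
  have hρ : E.sesq φ φ = ρ.withDensityᵥ fun _ => (1 : ℂ) := by
    ext X hX
    rw [withDensityᵥ_apply (integrable_const _) hX, ← (hs X hX).1]
    have := SignedMeasure.toMeasureOfZeroLE_real_apply s h0 MeasurableSet.univ hX
    rw [Set.univ_inter] at this
    simp [ρ, this]
  have hv : (E.sesq φ φ).variation = ρ := by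
    rw [hρ, Measure.variation_withDensityᵥ (integrable_const _)]
    simp
  rw [hv, hρ]

lemma inner_toFun_self (E : POVM Ω H) (φ : H) {X : Set Ω} (hX : MeasurableSet X) :
    ⟪φ, E.toFun X φ⟫_ℂ = ∫ _ in X, (1 : ℂ) ∂(E.sesq φ φ).variation := by
  rw [← sesq_apply, ← withDensityᵥ_apply (integrable_const _) hX, ← sesq_self_eq]

lemma inner_toFun_left (E : POVM Ω H) {X : Set Ω} (hX : MeasurableSet X) (ψ φ : H) :
    ⟪E.toFun X ψ, φ⟫_ℂ = ⟪ψ, E.toFun X φ⟫_ℂ :=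
  (E.isPositive X hX).inner_left_eq_inner_right ψ φ

lemma toFun_union (E : POVM Ω H) {X Y : Set Ω} (hd : Disjoint X Y) (hX : MeasurableSet X)
    (hY : MeasurableSet Y) : E.toFun (X ∪ Y) = E.toFun X + E.toFun Y := by
  ext φ
  refine ext_inner_left ℂ fun ψ => ?_
  have := VectorMeasure.of_union (v := E.sesq ψ φ) hd hX hY
  simpa [sesq_apply, inner_add_right] using this

/-- With p and q the two projections, p + q is again idempotent, which forces pq + qp = 0.
Multiplying by p on either side gives pq = -pqp = qp, hence 2pq = 0. -/
lemma IsSpectral.toFun_mul_eq_zero [CompleteSpace H] {E : POVM Ω H} (hE : E.IsSpectral)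
    {X Y : Set Ω} (hd : Disjoint X Y) (hX : MeasurableSet X) (hY : MeasurableSet Y) :
    E.toFun X * E.toFun Y = 0 := by
  have hp : E.toFun X * E.toFun X = E.toFun X := (hE.isStarProjection X hX).isIdempotentElem
  have hq : E.toFun Y * E.toFun Y = E.toFun Y := (hE.isStarProjection Y hY).isIdempotentElem
  have hr : E.toFun (X ∪ Y) * E.toFun (X ∪ Y) = E.toFun (X ∪ Y) :=
    (hE.isStarProjection _ (hX.union hY)).isIdempotentElem
  rw [E.toFun_union hd hX hY] at hr
  generalize E.toFun X = p at *
  generalize E.toFun Y = q at *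
  have h1 : p * q + q * p = 0 := by
    have : (p + q) * (p + q) = p * p + q * q + (p * q + q * p) := by noncomm_ring
    rw [this, hp, hq] at hr
    simpa using hr
  have h2 : p * q + p * q * p = 0 := by
    have : p * (p * q + q * p) = (p * p) * q + p * q * p := by noncomm_ring
    rw [h1, hp, mul_zero] at this
    exact this.symm
  have h3 : p * q * p + q * p = 0 := by
    have : (p * q + q * p) * p = p * q * p + q * (p * p) := by noncomm_ring
    rw [h1, hp, zero_mul] at this
    exact this.symm
  have h4 : p * q = q * p := by
    rw [eq_neg_of_add_eq_zero_left h2, eq_neg_of_add_eq_zero_right h3]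
  rw [← h4, ← two_smul ℂ] at h1
  exact (smul_eq_zero.1 h1).resolve_left two_ne_zero

/-- A spectral measure is multiplicative. -/
lemma IsSpectral.toFun_mul [CompleteSpace H] {E : POVM Ω H} (hE : E.IsSpectral)
    {X Y : Set Ω} (hX : MeasurableSet X) (hY : MeasurableSet Y) :
    E.toFun X * E.toFun Y = E.toFun (X ∩ Y) := by
  -- Split both sets along X ∩ Y; by orthogonality every term of the product vanishes except the
  -- square of E(X ∩ Y).
  have e₁ : E.toFun X = E.toFun (X ∩ Y) + E.toFun (X \ Y) := by
    rw [← E.toFun_union Set.disjoint_sdiff_inter.symm (hX.inter hY) (hX.diff hY),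
      Set.inter_union_sdiff]
  have e₂ : E.toFun Y = E.toFun (X ∩ Y) + E.toFun (Y \ X) := by
    rw [Set.inter_comm, ← E.toFun_union Set.disjoint_sdiff_inter.symm (hY.inter hX) (hY.diff hX),
      Set.inter_union_sdiff]
  rw [e₁, e₂, add_mul, mul_add, mul_add,
    hE.toFun_mul_eq_zero (by grind) (hX.inter hY) (hY.diff hX),
    hE.toFun_mul_eq_zero (by grind) (hX.diff hY) (hX.inter hY),
    hE.toFun_mul_eq_zero (by grind) (hX.diff hY) (hY.diff hX),
    (hE.isStarProjection _ (hX.inter hY)).isIdempotentElem.eq]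
  simp

lemma IsSpectral.inner_toFun_toFun [CompleteSpace H] {E : POVM Ω H} (hE : E.IsSpectral)
    {X Y : Set Ω} (hX : MeasurableSet X) (hY : MeasurableSet Y) (ψ φ : H) :
    ⟪E.toFun X ψ, E.toFun Y φ⟫_ℂ = ⟪ψ, E.toFun (X ∩ Y) φ⟫_ℂ := by
  rw [E.inner_toFun_left hX, ← hE.toFun_mul hX hY]
  rfl

end POVM

/-! ### Integrals with respect to a spectral measure. -/

namespace POVM

variable {Ω : Type*} [MeasurableSpace Ω] {H : Type*} [NormedAddCommGroup H]
  [InnerProductSpace ℂ H] {E : POVM Ω H} {f : Ω → ℝ}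

lemma integrable_of_mem_strongDomain {φ : H} (hφ : φ ∈ E.strongDomain f) :
    Integrable (fun x => (f x : ℂ)) (E.sesq φ φ).variation :=
  Integrable.ofReal (hφ φ)

/-- The square integrability domain is contained in the form domain. -/
lemma sqDomain_le_formDomain (E : POVM Ω H) (hf : Measurable f) :
    E.sqDomain f ≤ E.formDomain f :=
  fun φ hφ => E.sqDomain_le_strongDomain hf hφ φ

variable [CompleteSpace H]

/-- By multiplicativity, passing from φ to E(X)φ in one slot cuts the measure E_{φ,φ} down to X. -/
lemma IsSpectral.sesq_toFun_self (hE : E.IsSpectral) {X : Set Ω} (hX : MeasurableSet X) (φ : H) :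
    E.sesq (E.toFun X φ) φ =
      (E.sesq φ φ).variation.withDensityᵥ (X.indicator fun _ => (1 : ℂ)) := by
  ext Y hY
  rw [sesq_apply, hE.inner_toFun_toFun hX hY, E.inner_toFun_self φ (hX.inter hY),
    withDensityᵥ_apply ((integrable_const _).indicator hX) hY, setIntegral_indicator hX,
    Set.inter_comm]

/-- Test the defining identity of Lφ on ψ = E(X)φ; the conjugation from swapping the slots is
harmless because f is real. -/
lemma IsSpectral.inner_strongOp_toFun (hE : E.IsSpectral) (hf : Measurable f)
    (φ : (E.strongOp f hf).domain) {X : Set Ω} (hX : MeasurableSet X) :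
    ⟪E.strongOp f hf φ, E.toFun X φ⟫_ℂ =
      ∫ x in X, (f x : ℂ) ∂(E.sesq (φ : H) φ).variation := by
  have hi := (show (φ : H) ∈ E.strongDomain f from φ.2) (E.toFun X φ)
  rw [hE.sesq_toFun_self hX] at hi
  rw [← inner_conj_symm, inner_strongOp, hE.sesq_toFun_self hX,
    Measure.integral_withDensityᵥ ((integrable_const _).indicator hX) hf hi,
    ← integral_conj, ← integral_indicator hX]
  refine integral_congr_ae (ae_of_all _ fun x => ?_)
  by_cases hx : x ∈ X <;> simp [hx]

/-- For a spectral measure, `E_{L(f,E)φ,φ}` has density `f` with respect to `E_{φ,φ}`. -/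
lemma IsSpectral.sesq_strongOp_left (hE : E.IsSpectral) (hf : Measurable f)
    (φ : (E.strongOp f hf).domain) :
    E.sesq (E.strongOp f hf φ) φ =
      (E.sesq (φ : H) φ).variation.withDensityᵥ fun x => (f x : ℂ) := by
  ext X hX
  rw [sesq_apply, hE.inner_strongOp_toFun hf φ hX,
    withDensityᵥ_apply (integrable_of_mem_strongDomain φ.2) hX]

/-- For a spectral measure, the domain of `L(f, E)` is the square integrability domain. -/
lemma IsSpectral.strongDomain_le_sqDomain (hE : E.IsSpectral) (hf : Measurable f) :
    E.strongDomain f ≤ E.sqDomain f := by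
  intro φ hφ
  -- The decisive test vector is Lφ itself: its measure E_{Lφ,φ} is f·E_{φ,φ}, so integrability of f
  -- against it is integrability of f².
  have h := hφ (E.strongOp f hf ⟨φ, hφ⟩)
  rw [hE.sesq_strongOp_left hf ⟨φ, hφ⟩,
    Measure.integrable_withDensityᵥ_iff (integrable_of_mem_strongDomain hφ)] at h
  change Integrable (fun x => f x ^ 2) (E.sesq φ φ).variation
  refine h.norm.congr (ae_of_all _ fun x => ?_)
  simp [sq, abs_mul_abs_self]

lemma IsSpectral.integrable_sq (hE : E.IsSpectral) (hf : Measurable f) {φ : H}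
    (hφ : φ ∈ E.strongDomain f) :
    Integrable (fun x => (f x : ℂ) ^ 2) (E.sesq φ φ).variation := by
  have h : Integrable (fun x => f x ^ 2) (E.sesq φ φ).variation :=
    hE.strongDomain_le_sqDomain hf hφ
  simpa using h.ofReal (𝕜 := ℂ)

/-- For a spectral measure, `E_{L(f,E)φ,L(f,E)φ}` has density `f²` with respect to `E_{φ,φ}`. -/
lemma IsSpectral.sesq_strongOp_self (hE : E.IsSpectral) (hf : Measurable f)
    (φ : (E.strongOp f hf).domain) :
    E.sesq (E.strongOp f hf φ) (E.strongOp f hf φ) =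
      (E.sesq (φ : H) φ).variation.withDensityᵥ fun x => (f x : ℂ) ^ 2 := by
  have hfi := integrable_of_mem_strongDomain φ.2
  ext X hX
  -- Since E(X) can be moved to the left slot, E_{Lφ,Lφ}(X) is the integral of f against
  -- E_{E(X)Lφ,φ}, and that measure has density f on X.
  have hd : E.sesq (E.toFun X (E.strongOp f hf φ)) φ =
      (E.sesq (φ : H) φ).variation.withDensityᵥ (X.indicator fun x => (f x : ℂ)) := by
    ext Y hY
    rw [sesq_apply, hE.inner_toFun_toFun hX hY, hE.inner_strongOp_toFun hf φ (hX.inter hY),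
      withDensityᵥ_apply (hfi.indicator hX) hY, setIntegral_indicator hX, Set.inter_comm]
  have hi := (show (φ : H) ∈ E.strongDomain f from φ.2) (E.toFun X (E.strongOp f hf φ))
  rw [hd] at hi
  rw [sesq_apply, ← E.inner_toFun_left hX, inner_strongOp, hd,
    Measure.integral_withDensityᵥ (hfi.indicator hX) hf hi,
    withDensityᵥ_apply (hE.integrable_sq hf φ.2) hX, ← integral_indicator hX]
  refine integral_congr_ae (ae_of_all _ fun x => ?_)
  by_cases hx : x ∈ X <;> simp [hx, sq]

/-- Normalization makes ‖Lφ‖² the total mass of E_{Lφ,Lφ} = f²·E_{φ,φ}. -/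
lemma IsSpectral.inner_strongOp_self (hE : E.IsSpectral) (hf : Measurable f)
    (φ : (E.strongOp f hf).domain) :
    ⟪E.strongOp f hf φ, E.strongOp f hf φ⟫_ℂ = ∫ᵛ x, f x ^ 2 ∂•(E.sesq (φ : H) φ) := by
  have h1 : ⟪E.strongOp f hf φ, E.strongOp f hf φ⟫_ℂ =
      E.sesq (E.strongOp f hf φ) (E.strongOp f hf φ) Set.univ := by
    rw [sesq_apply, hE.isNormalized]; rfl
  have hi : (E.sesq (φ : H) φ).Integrable fun x => f x ^ 2 :=
    hE.strongDomain_le_sqDomain hf φ.2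
  rw [sesq_self_eq] at hi
  rw [h1, hE.sesq_strongOp_self, withDensityᵥ_apply (hE.integrable_sq hf φ.2) .univ,
    setIntegral_univ]
  conv_rhs => rw [sesq_self_eq]
  rw [Measure.integral_withDensityᵥ (integrable_const _) (hf.pow_const 2) hi]
  simp

/-- For a spectral measure, `⟪L(f,E)ψ, L(f,E)φ⟫ = ∫ f² dE_{ψ,φ}`. -/
lemma IsSpectral.inner_strongOp_strongOp (hE : E.IsSpectral) (hf : Measurable f)
    (ψ φ : (E.strongOp f hf).domain) :
    ⟪E.strongOp f hf ψ, E.strongOp f hf φ⟫_ℂ = ∫ᵛ x, f x ^ 2 ∂•(E.sesq (ψ : H) φ) := by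
  have hi : ∀ a b : (E.strongOp f hf).domain,
      (E.sesq (a : H) b).Integrable fun x => f x ^ 2 := fun a b =>
    E.integrable_sesq (hE.strongDomain_le_sqDomain hf a.2) (hE.strongDomain_le_sqDomain hf b.2)
  -- Polarization: expanding the diagonal identity at cψ + φ leaves conj c · A + c · B = 0 for the
  -- two off-diagonal defects A and B. Taking c = 1 and c = i gives 2A = 0.
  have expand : ∀ c : ℂ,
      conj c * (⟪E.strongOp f hf ψ, E.strongOp f hf φ⟫_ℂ - ∫ᵛ x, f x ^ 2 ∂•(E.sesq (ψ : H) φ)) +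
      c * (⟪E.strongOp f hf φ, E.strongOp f hf ψ⟫_ℂ - ∫ᵛ x, f x ^ 2 ∂•(E.sesq (φ : H) ψ))
        = 0 := by
    intro c
    have h := hE.inner_strongOp_self hf (c • ψ + φ)
    have hφ := hE.inner_strongOp_self hf φ
    have hc := hE.inner_strongOp_self hf (c • ψ)
    have e₁ : ∫ᵛ x, f x ^ 2 ∂•(E.sesq ((c • ψ + φ : (E.strongOp f hf).domain) : H)
          ((c • ψ + φ : (E.strongOp f hf).domain) : H)) =
        ∫ᵛ x, f x ^ 2 ∂•(E.sesq ((c • ψ : (E.strongOp f hf).domain) : H)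
          ((c • ψ : (E.strongOp f hf).domain) : H)) +
        conj c * ∫ᵛ x, f x ^ 2 ∂•(E.sesq (ψ : H) φ) +
        (c * ∫ᵛ x, f x ^ 2 ∂•(E.sesq (φ : H) ψ) + ∫ᵛ x, f x ^ 2 ∂•(E.sesq (φ : H) φ)) := by
      have h₁ := hi (c • ψ) (c • ψ + φ)
      have h₂ := hi φ (c • ψ + φ)
      rw [Submodule.coe_add] at h₁ h₂ ⊢
      rw [E.integral_add_left h₁ h₂,
        E.integral_add_right (hi (c • ψ) (c • ψ)) (hi (c • ψ) φ),
        E.integral_add_right (hi φ (c • ψ)) (hi φ φ), Submodule.coe_smul,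
        E.integral_smul_left c (hi ψ φ), E.integral_smul_right c (hi φ ψ)]
    rw [e₁, ← hc, ← hφ, LinearPMap.map_add, LinearPMap.map_smul] at h
    simp only [inner_add_left, inner_add_right, inner_smul_left, inner_smul_right] at h
    linear_combination h
  have h1 := expand 1
  have h2 := expand Complex.I
  simp only [map_one, one_mul, Complex.conj_I] at h1 h2
  have h3 : (2 : ℂ) * (⟪E.strongOp f hf ψ, E.strongOp f hf φ⟫_ℂ -
      ∫ᵛ x, f x ^ 2 ∂•(E.sesq (ψ : H) φ)) = 0 := by
    linear_combination h1 + Complex.I * h2 + (-(⟪E.strongOp f hf ψ, E.strongOp f hf φ⟫_ℂ -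
      ∫ᵛ x, f x ^ 2 ∂•(E.sesq (ψ : H) φ)) + (⟪E.strongOp f hf φ, E.strongOp f hf ψ⟫_ℂ -
      ∫ᵛ x, f x ^ 2 ∂•(E.sesq (φ : H) ψ))) * (-Complex.I_mul_I)
  exact sub_eq_zero.1 ((mul_eq_zero.1 h3).resolve_left two_ne_zero)

/-- For a spectral measure, the domain of `L(f,E)²` is contained in the square integrability domain
of `f²`. -/
lemma IsSpectral.mem_sqDomain_sq (hE : E.IsSpectral) (hf : Measurable f)
    (φ : (E.strongOp f hf).domain) (h : E.strongOp f hf φ ∈ E.strongDomain f) :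
    (φ : H) ∈ E.sqDomain fun x => f x ^ 2 := by
  -- Integrability of f² against f²·E_{φ,φ} is integrability of f⁴ against E_{φ,φ}.
  have h1 : (E.sesq (E.strongOp f hf φ) (E.strongOp f hf φ)).Integrable fun x => f x ^ 2 :=
    hE.strongDomain_le_sqDomain hf h
  rw [hE.sesq_strongOp_self, Measure.integrable_withDensityᵥ_iff (hE.integrable_sq hf φ.2)] at h1
  change Integrable (fun x => (f x ^ 2) ^ 2) (E.sesq (φ : H) φ).variation
  refine h1.congr (ae_of_all _ fun x => ?_)
  simp; ring

lemma sqDomain_le_weakDomain (E : POVM Ω H) (hf : Measurable f) :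
    E.sqDomain f ≤ E.weakDomain f := fun _ hφ =>
  ⟨E.sqDomain_le_formDomain hf hφ, (E.continuous_integral_of_mem_strongDomain hf
    (E.sqDomain_le_strongDomain hf hφ)).comp continuous_subtype_val⟩

/-- If the form domain is dense, `L'(f, E)` extends `L̃(f, E)`. -/
lemma sqOp_le_weakOp (E : POVM Ω H) (hf : Measurable f)
    (hD : Dense (E.formDomain f : Set H)) : E.sqOp f hf ≤ E.weakOp f := by
  refine ⟨E.sqDomain_le_weakDomain hf, fun x y hxy => ?_⟩
  refine hD.eq_of_inner_right ℂ fun ψ hψ => ?_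
  have h1 : E.sqOp f hf x = E.strongOp f hf ⟨x, E.sqDomain_le_strongDomain hf x.2⟩ := rfl
  rw [E.inner_weakOp f hD y hψ, h1, inner_strongOp, hxy]

/-! ### Transfer along a Naimark dilation. -/

section Dilation

variable {K : Type*} [NormedAddCommGroup K] [InnerProductSpace ℂ K] [CompleteSpace K]
  {F : POVM Ω K} {V : H →L[ℂ] K}

lemma IsNaimarkDilation.sesq_eq (h : E.IsNaimarkDilation F V) (ψ φ : H) :
    E.sesq ψ φ = F.sesq (V ψ) (V φ) := by
  ext X hX
  simp [sesq_apply, h.eq_compression X hX, ContinuousLinearMap.adjoint_inner_right]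

lemma IsNaimarkDilation.mem_formDomain_iff (h : E.IsNaimarkDilation F V) {φ : H} :
    φ ∈ E.formDomain f ↔ V φ ∈ F.formDomain f := by
  change (E.sesq φ φ).Integrable f ↔ (F.sesq (V φ) (V φ)).Integrable f
  rw [h.sesq_eq]

/-- For F the strong and square integrability domains coincide, and the latter depends only on
diagonal measures, which V transports. -/
lemma IsNaimarkDilation.mem_strongDomain_iff (h : E.IsNaimarkDilation F V) (hf : Measurable f)
    {φ : H} : V φ ∈ F.strongDomain f ↔ φ ∈ E.sqDomain f :=
  ⟨fun hφ => h.mem_formDomain_iff.2 (h.isSpectral.strongDomain_le_sqDomain hf hφ),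
    fun hφ => F.sqDomain_le_strongDomain hf (h.mem_formDomain_iff.1 hφ)⟩

/-- The square integrability operator is the compression V*LV. -/
lemma IsNaimarkDilation.sqOp_apply (h : E.IsNaimarkDilation F V) (hf : Measurable f)
    (φ : (E.sqOp f hf).domain) :
    E.sqOp f hf φ = ContinuousLinearMap.adjoint V
      (F.strongOp f hf ⟨V φ, (h.mem_strongDomain_iff hf).2 φ.2⟩) := by
  refine ext_inner_left ℂ fun ψ => ?_
  have h1 : E.sqOp f hf φ = E.strongOp f hf ⟨φ, E.sqDomain_le_strongDomain hf φ.2⟩ := rfl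
  rw [h1, inner_strongOp, ContinuousLinearMap.adjoint_inner_right, inner_strongOp, h.sesq_eq]

/-- Comparing E and F on the whole space, where both equal the identity, shows that V is an
isometry. -/
lemma IsNaimarkDilation.adjoint_apply_apply (h : E.IsNaimarkDilation F V) (hE : E.IsNormalized)
    (φ : H) : ContinuousLinearMap.adjoint V (V φ) = φ := by
  have h1 := h.eq_compression _ MeasurableSet.univ
  rw [hE, h.isSpectral.isNormalized] at h1
  exact (congrArg (fun T : H →L[ℂ] H => T φ) h1).symm

lemma IsNaimarkDilation.integral_sq (h : E.IsNaimarkDilation F V) (hf : Measurable f)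
    {ψ φ : H} (hψ : ψ ∈ E.sqDomain f) (hφ : φ ∈ E.sqDomain f) :
    ∫ᵛ x, f x ^ 2 ∂•(E.sesq ψ φ) =
      ⟪F.strongOp f hf ⟨V ψ, (h.mem_strongDomain_iff hf).2 hψ⟩,
        F.strongOp f hf ⟨V φ, (h.mem_strongDomain_iff hf).2 hφ⟩⟫_ℂ := by
  rw [h.sesq_eq, h.isSpectral.inner_strongOp_strongOp hf]

/-- If `V* L(f, F) = (L(f, F) V)*`, then `L̃(f², E) = L'(f², E)`. -/
theorem IsNaimarkDilation.sqOp_sq_eq_weakOp_sq (h : E.IsNaimarkDilation F V) (hf : Measurable f)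
    (hD : Dense (E.sqDomain f : Set H))
    (hadj : (ContinuousLinearMap.adjoint V).toFullPMap.compNatural (F.strongOp f hf) =
      ((F.strongOp f hf).compNatural V.toFullPMap).adjoint) :
    E.sqOp (fun x => f x ^ 2) (hf.pow_const 2) = E.weakOp fun x => f x ^ 2 := by
  refine LinearPMap.eq_of_le_of_domain_eq (E.sqOp_le_weakOp (hf.pow_const 2) hD)
    (le_antisymm (E.sqDomain_le_weakDomain (hf.pow_const 2)) ?_)
  -- The form domain of f² is by definition the square integrability domain of f.
  rintro φ ⟨hφ : φ ∈ E.sqDomain f, hc⟩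
  have hVφ : V φ ∈ F.strongDomain f := (h.mem_strongDomain_iff hf).2 hφ
  set T := (F.strongOp f hf).compNatural V.toFullPMap with hT
  have hTdom : ∀ x : T.domain, (x : H) ∈ E.sqDomain f := fun x =>
    (h.mem_strongDomain_iff hf).1 x.2.snd
  have hmem : F.strongOp f hf ⟨V φ, hVφ⟩ ∈ T.adjoint.domain := by
    rw [LinearPMap.mem_adjoint_domain_iff]
    -- The weak functional is antilinear in ψ while the adjoint domain is tested with a linear one,
    -- hence the conjugation.
    have hc' := Complex.continuous_conj.comp
      (hc.comp (Continuous.subtype_mk continuous_subtype_val hTdom))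
    refine hc'.congr fun x => ?_
    change conj (∫ᵛ y, f y ^ 2 ∂•(E.sesq (x : H) φ)) = ⟪_, _⟫_ℂ
    rw [h.integral_sq hf (hTdom x) hφ, inner_conj_symm]
    rfl
  -- Only the equality of domains matters here: D(V*L) = D(L), so LVφ ∈ D(L).
  rw [← hadj] at hmem
  exact h.mem_formDomain_iff.2 (h.isSpectral.mem_sqDomain_sq hf ⟨V φ, hVφ⟩ hmem.fst)

/-- If `L(f, F)` maps `D(L(f, F)) ∩ V(H)` to `V(H)`, then `L'(f², E) = L̃(f, E)* L̃(f, E)`. -/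
theorem IsNaimarkDilation.weakOp_sq_eq (h : E.IsNaimarkDilation F V) (hE : E.IsNormalized)
    (hf : Measurable f) (hD : Dense (E.sqDomain f : Set H))
    (hinv : ∀ x : (F.strongOp f hf).domain, (x : K) ∈ Set.range V →
      F.strongOp f hf x ∈ Set.range V) :
    E.weakOp (fun x => f x ^ 2) = (E.sqOp f hf).adjoint.compNatural (E.sqOp f hf) := by
  have hint : ∀ ψ φ : (E.sqOp f hf).domain, ∫ᵛ x, f x ^ 2 ∂•(E.sesq (ψ : H) φ) =
      ⟪E.sqOp f hf ψ, E.sqOp f hf φ⟫_ℂ := by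
    intro ψ φ
    -- Invariance gives LVφ = Vη, and V*V = I identifies η with V*LVφ. Hence V* can be moved to the
    -- left factor without losing a component orthogonal to the range of V.
    obtain ⟨η, hη⟩ := hinv ⟨V φ, (h.mem_strongDomain_iff hf).2 φ.2⟩ ⟨φ, rfl⟩
    rw [h.integral_sq hf ψ.2 φ.2, h.sqOp_apply hf φ, ← hη, h.adjoint_apply_apply hE,
      h.sqOp_apply hf ψ, ContinuousLinearMap.adjoint_inner_left]
  refine LinearPMap.ext (Submodule.ext fun φ => ?_) fun φ hφ hφ' => ?_
  · have key : ∀ hφ : φ ∈ E.sqDomain f,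
        (Continuous fun ψ : E.formDomain (fun x => f x ^ 2) =>
          ∫ᵛ x, f x ^ 2 ∂•(E.sesq (ψ : H) φ)) ↔
        E.sqOp f hf ⟨φ, hφ⟩ ∈ (E.sqOp f hf).adjoint.domain := by
      intro hφ
      rw [LinearPMap.mem_adjoint_domain_iff]
      have e : ∀ ψ : (E.sqOp f hf).domain, conj (∫ᵛ x, f x ^ 2 ∂•(E.sesq (ψ : H) φ)) =
          ⟪E.sqOp f hf ⟨φ, hφ⟩, E.sqOp f hf ψ⟫_ℂ := fun ψ => by
        rw [hint ψ ⟨φ, hφ⟩, inner_conj_symm]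
      constructor
      · intro hc
        exact (Complex.continuous_conj.comp hc).congr e
      · intro hc
        refine (Complex.continuous_conj.comp hc).congr fun ψ => ?_
        have := congrArg conj (e ψ)
        rw [Complex.conj_conj] at this
        exact this.symm
    exact ⟨fun hφ => ⟨hφ.1, (key hφ.1).1 hφ.2⟩, fun hφ => ⟨hφ.fst, (key hφ.fst).2 hφ.snd⟩⟩
  -- The two values have the same inner products with the dense domain, by the form identity and the
  -- defining property of the adjoint.
  · refine hD.eq_of_inner_right ℂ fun ψ hψ => ?_
    rw [E.inner_weakOp (fun x => f x ^ 2) hD ⟨φ, hφ⟩ hψ, hint ⟨ψ, hψ⟩ ⟨φ, hφ.1⟩]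
    exact ((LinearPMap.adjoint_isFormalAdjoint hD).symm ⟨ψ, hψ⟩
      ⟨E.sqOp f hf ⟨φ, hφ'.fst⟩, hφ'.snd⟩)

end Dilation

end POVM

/-! ### Specialization to powers, with f(x) = x^j and f² = x^(2j). -/

theorem mainTheorem6 {H K : Type*}
    [NormedAddCommGroup H] [InnerProductSpace ℂ H] [CompleteSpace H]
    [NormedAddCommGroup K] [InnerProductSpace ℂ K] [CompleteSpace K]
    (E : POVM ℝ H) (hE : E.IsNormalized)
    (F : POVM ℝ K) (V : H →L[ℂ] K) (hdil : E.IsNaimarkDilation F V)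
    (j : ℕ) (hdense : Dense ((E.sqMoment j).domain : Set H)) :
    ((ContinuousLinearMap.adjoint V).toFullPMap.compNatural (F.strongMoment j) =
        ((F.strongMoment j).compNatural V.toFullPMap).adjoint →
      E.sqMoment (2 * j) = E.weakMoment (2 * j)) ∧
    ((∀ x : (F.strongMoment j).domain, (x : K) ∈ Set.range V →
        F.strongMoment j x ∈ Set.range V) →
      E.weakMoment (2 * j) = (E.sqMoment j).adjoint.compNatural (E.sqMoment j)) := by
  have hf : Measurable fun x : ℝ => x ^ j := measurable_id.pow_const j
  have hpow : (fun x : ℝ => x ^ (2 * j)) = fun x => (x ^ j) ^ 2 := by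
    funext x; rw [← pow_mul, mul_comm]
  unfold POVM.sqMoment POVM.weakMoment POVM.strongMoment
  simp only [hpow]
  exact ⟨fun h => hdil.sqOp_sq_eq_weakOp_sq hf hdense h,
    fun h => hdil.weakOp_sq_eq hE hf hdense h⟩
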